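/- An election with $3$ candidates consists of $n\ge 1$ voters, each of whom submits a strict ranking of the candidates $1,2,3$. Voters and candidates lie in an unknown metric space (several of them may occupy the same point) with distance $d$, which is consistent with the rankings: if voter $v$ ranks $i$ above $j$, then $d(i,v)\le d(j,v)$. The social cost of a candidate is $\mathrm{SC}(i,d)=\frac1n\sum_v d(i,v)$. A randomized mechanism maps every election to a probability vector $(p_1,p_2,p_3)$ on the candidates, seeing only the rankings. The distortion of $p$ on an election is the supremum of $\sum_i p_i\,\mathrm{SC}(i,d)\big/\min_j \mathrm{SC}(j,d)$ over all consistent $d$ (with $0/0=0$ and $x/0=\infty$ for $x>0$), and the distortion of a mechanism is the supremum over all elections. Let $$\beta(a,b)=\frac{-b(1-b)+(1-a)}{a}+\frac{(1-b)^2+b(a+b)}{1-a},$$ $$R=\Big\{(a,b): 0<a<1,\ 0<b<\tfrac12,\ a+b\le 1,\ \tfrac{b(1-b)}{1-a}<1\Big\}.$$ For $(a,b)\in R$ call an election in which the rankings $(1,3,2)$, $(2,3,1)$, $(3,2,1)$ occur in proportions $a$, $b$, $1-(a+b)$ a *lower-bound election* with parameters $(a,b)$. **Theorem.** The function $\beta$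 attains its minimum $\beta^*$ over $R$, and $1+2/\beta^*$ is the optimal distortion for $3$ candidates: 1. there is a randomized mechanism on $3$ candidates with distortion exactly $1+2/\beta^*$; 2. every randomized mechanism on $3$ candidates has distortion at least $1+2/\beta^*$; 3. on every lower-bound election with parameters $(a,b)\in R$, every probability vector on the candidates has distortion at least $1+2/\beta(a,b)$, and the supremum, over all lower-bound elections, of the best distortion attainable on the election equals $1+2/\beta^*$; so these elections are the worst case. Moreover $2.02612<1+2/\beta^*<2.02613$. -/

import Mathlib

open scoped ENNReal

namespace MetricDistortion

/-- An election with voters `Fin n` and candidates `Fin m`: each voter `v` submits a ranking, and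
`σ v k` is the candidate that `v` puts in position `k` (position `0` is the favourite). -/
abbrev Election (n m : ℕ) : Type := Fin n → Equiv.Perm (Fin m)

/-- Voter `v` prefers candidate `i` to candidate `j`. -/
def Prefers {n m : ℕ} (σ : Election n m) (v : Fin n) (i j : Fin m) : Prop :=
  (σ v).symm i < (σ v).symm j

/-- An underlying metric: a distance on voters and candidates. Distinct voters or candidates may
occupy the same point, so this is a pseudometric. -/
abbrev HiddenMetric (n m : ℕ) : Type := PseudoMetricSpace (Fin n ⊕ Fin m)

/-- The distance between candidate `i` and voter `v`. -/
noncomputable def candDist {n m : ℕ} (d : HiddenMetric n m) (i : Fin m) (v : Fin n) : ℝ :=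
  d.dist (Sum.inr i) (Sum.inl v)

/-- The metric is consistent with the rankings: preferred candidates are at least as close. -/
def Consistent {n m : ℕ} (d : HiddenMetric n m) (σ : Election n m) : Prop :=
  ∀ (v : Fin n) (i j : Fin m), Prefers σ v i j → candDist d i v ≤ candDist d j v

/-- The social cost of a candidate: the average distance to the voters. -/
noncomputable def socialCost {n m : ℕ} (d : HiddenMetric n m) (i : Fin m) : ℝ :=
  (1 / (n : ℝ)) * ∑ v : Fin n, candDist d i v

/-- A lottery over the candidates. -/
abbrev Lottery (m : ℕ) : Type := stdSimplex ℝ (Fin m)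

/-- The expected social cost of a candidate drawn from the lottery `p`. -/
noncomputable def expectedCost {n m : ℕ} (d : HiddenMetric n m) (p : Lottery m) : ℝ :=
  ∑ i : Fin m, (p : Fin m → ℝ) i * socialCost d i

/-- Expected social cost divided by the least social cost, as an extended nonnegative real:
here `x / 0 = ∞` for `x > 0`, and `0 / 0 = 0`. -/
noncomputable def approxRatio {n m : ℕ} (d : HiddenMetric n m) (p : Lottery m) : ℝ≥0∞ :=
  ENNReal.ofReal (expectedCost d p) / ENNReal.ofReal (⨅ j : Fin m, socialCost d j)

/-- The worst-case distortion of the lottery `p` on the election `σ`. -/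
noncomputable def lotteryDistortion {n m : ℕ} (σ : Election n m) (p : Lottery m) : ℝ≥0∞ :=
  ⨆ (d : HiddenMetric n m) (_ : Consistent d σ), approxRatio d p

/-- The best distortion that any lottery guarantees on the election `σ`. -/
noncomputable def electionDistortion {n m : ℕ} (σ : Election n m) : ℝ≥0∞ :=
  ⨅ p : Lottery m, lotteryDistortion σ p

/-- A randomized mechanism for `m` candidates sees only the rankings and outputs a lottery. -/
abbrev Mechanism (m : ℕ) : Type := ∀ n : ℕ, Election n m → Lottery m

/-- The worst-case distortion of a mechanism, over all elections with at least one voter and all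
consistent metrics. -/
noncomputable def distortion {m : ℕ} (f : Mechanism m) : ℝ≥0∞ :=
  ⨆ (n : ℕ) (_ : 0 < n) (σ : Election n m), lotteryDistortion σ (f n σ)

/-- The proportion of voters who submit the ranking `r` (listed from first to last). -/
noncomputable def rankingShare {n m : ℕ} (σ : Election n m) (r : Fin m → Fin m) : ℝ :=
  ((Finset.univ.filter fun v : Fin n => ⇑(σ v) = r).card : ℝ) / (n : ℝ)

/-- The three-candidate elections of the lower bound: with candidates called `1, 2, 3`, the
rankings `(1,3,2)`, `(2,3,1)`, `(3,2,1)` occur in proportions `a`, `b`, `1 - (a + b)`. -/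
def IsHardElection {n : ℕ} (σ : Election n 3) (a b : ℝ) : Prop :=
  rankingShare σ ![0, 2, 1] = a ∧ rankingShare σ ![1, 2, 0] = b ∧
    rankingShare σ ![2, 1, 0] = 1 - (a + b)

/-- The admissible parameters of the lower-bound elections. -/
def admissible : Set (ℝ × ℝ) :=
  {x | 0 < x.1 ∧ x.1 < 1 ∧ 0 < x.2 ∧ x.2 < 1 / 2 ∧ x.1 + x.2 ≤ 1 ∧
    x.2 * (1 - x.2) / (1 - x.1) < 1}

/-- The quantity `β(a, b)`; the election with parameters `a, b` gives the distortion lower bound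
`1 + 2 / β(a, b)`. -/
noncomputable def beta (x : ℝ × ℝ) : ℝ :=
  (-(x.2 * (1 - x.2)) + (1 - x.1)) / x.1 + ((1 - x.2) ^ 2 + x.2 * (x.1 + x.2)) / (1 - x.1)

end MetricDistortion

/-!
For an election `σ`, let `A i j` be the share of voters preferring `i` to `j`, and `F i`, `L i` the
shares ranking `i` first and last.

*Upper bound.* Fix an optimal candidate `k` and let the other two lie at distances `X ≤ Y` from it.
The triangle inequality and consistency bound the regret and the cost of every single voter by
functions linear in `X` and `Y - X` (`voter_bounds`). A lottery `p` therefore has distortion at most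
`1 + 2 / β` as soon as it satisfies, for all `i`,

* `β * p i * L i ≤ 1 - L i`,
* `β * ∑ j ≠ i, p j * A i j ≤ 1 - F i`.

Lotteries form a two-dimensional set, so by Helly's theorem (`helly_four`) it is enough to satisfy
all last-place constraints together with any two first-place ones, which a lottery between two
candidates does (`exists_duel`), and to satisfy the three first-place constraints at a point of the
affine plane `∑ p i = 1`, where negative coordinates are allowed. For the latter (`exists_balanced`)
the point is a multiple of `adj A` applied to `1 - F`; it works if `β * det A` is at most
`∑ i, μ i * (1 - F i)`, where `μ = 𝟙ᵀ adj A`. This inequality (`det_le`) is linear in `F` for given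
`A`, which reduces it to elections with only four of the six rankings. Up to symmetry there are
three kinds (`gap_nonneg_of_never_last`, `gap_nonneg_of_two_absent`,
`two_mul_det_le_of_never_first`); the lower-bound elections lie on the common boundary of the first
two, and on them the inequality says exactly that `β ≤ beta (a, b)`.

*Lower bound.* On a lower-bound election three explicit metrics, one for each optimal candidate,
turn the first-place constraints into necessary conditions, and the combination of these with
weights `μ` gives `1 + 2 / beta (a, b)` (`IsHardElection.le_electionDistortion`). The minimizer of
`beta` is approximated by rational parameters.

*The minimum.* With denominators cleared, `beta` is quadratic in `b`, so that the minimum is that of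
a rational function of `a` alone, attained on a compact interval (`exists_optimum`).
-/

namespace MetricDistortion

/-! ### Polynomial inequalities behind the feasibility of a lottery -/

/-- `β` bounds `beta` from below on the whole strip `0 < a < 1`, `b ∈ ℝ`; denominators are cleared,
so that the condition also makes sense at `a = 0` and `a = 1`. -/
def Envelope (β : ℝ) : Prop :=
  ∀ a b : ℝ, 0 ≤ a → a ≤ 1 →
    0 ≤ (1 + a) * b ^ 2 - (1 + a - a ^ 2) * b + (1 - a + a ^ 2) - β * a * (1 - a)

/-- Minimizing over `b`, a quadratic with discriminant equal to the negative of the quartic in `hg`,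
reduces the bound to one variable. -/
theorem envelope_nonneg {β a : ℝ} (b : ℝ) (h0 : 0 ≤ a)
    (hg : 0 ≤ 3 - 2 * a + a ^ 2 + 6 * a ^ 3 - a ^ 4 - 4 * β * a * (1 - a ^ 2)) :
    0 ≤ (1 + a) * b ^ 2 - (1 + a - a ^ 2) * b + (1 - a + a ^ 2) - β * a * (1 - a) := by
  have h : 0 ≤ 4 * (1 + a) * ((1 + a) * b ^ 2 - (1 + a - a ^ 2) * b + (1 - a + a ^ 2)
      - β * a * (1 - a)) := by
    have := sq_nonneg (2 * (1 + a) * b - (1 + a - a ^ 2))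
    nlinarith
  exact nonneg_of_mul_nonneg_right h (by linarith)

/-- The determinant inequality when candidate `3` is never last: the rankings `132`, `231`, `312`
have shares `a`, `b`, `s`, and `321` has the rest. The gap, the difference of the two sides of
`det_le`, is at fixed `u = a + b` a constant plus a quadratic form in `D = a - b` and
`T = (1 - u) / 2 - s`; minimized over `D` it is affine in `T ^ 2`, and at
`T ^ 2 = (1 - u) ^ 2 / 4` it is an instance of `Envelope`. -/
theorem gap_nonneg_of_never_last {β : ℝ} (h1 : 1.949 ≤ β) (h2 : β ≤ 1.9494)
    (hH : Envelope β)
    {a b s : ℝ} (ha : 0 ≤ a) (hb : 0 ≤ b) (hs : 0 ≤ s) (habs : a + b + s ≤ 1) :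
    0 ≤ (1 + a) * b ^ 2 - (1 + a - a ^ 2) * b + (1 - a + a ^ 2) - β * a * (1 - a)
      + s * (β * (a - b) - (1 - a - b) * (a + b)) + (a + b) * s ^ 2 := by
  obtain ⟨u, hu⟩ : ∃ u, u = a + b := ⟨_, rfl⟩
  obtain ⟨T, hT⟩ : ∃ T, T = (1 - u) / 2 - s := ⟨_, rfl⟩
  obtain ⟨A, hA⟩ : ∃ A, A = 3 - u + β := ⟨_, rfl⟩
  obtain ⟨K, hK⟩ : ∃ K, K = 1 - u * (5 / 4 + β / 2) + u ^ 2 * (3 / 4 + β / 4) := ⟨_, rfl⟩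
  have hu0 : 0 ≤ u := by linarith
  have hu1 : u ≤ 1 := by linarith
  have hApos : 0 < A := by linarith
  -- The end `T = 0`: the discriminant is nonpositive because `β ^ 2 + β ≤ 23 / 4`.
  have hKnn : 0 ≤ K := by
    have h : 0 ≤ (3 + β) * K := by
      rw [hK]
      nlinarith [sq_nonneg (2 * (3 / 4 + β / 4) * u - (5 / 4 + β / 2)), mul_nonneg hu0 hu0]
    exact nonneg_of_mul_nonneg_right h (by linarith)
  -- The end `T ^ 2 = (1 - u) ^ 2 / 4`, at the minimizing `D`.
  have hEnd : 0 ≤ A * K + ((1 - u) ^ 2 / 4) * (A * u - β ^ 2) := by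
    obtain ⟨D, hD⟩ : ∃ D, D = β * (1 - u) / A := ⟨_, rfl⟩
    have hDA : A * D = β * (1 - u) := by rw [hD]; field_simp
    have hD0 : 0 ≤ D := by rw [hD]; apply div_nonneg _ hApos.le; nlinarith
    have hD1 : D ≤ 1 - u := by
      rw [hD, div_le_iff₀ hApos]; nlinarith
    have := hH ((u + D) / 2) ((u - D) / 2) (by linarith) (by linarith)
    have h3 := mul_nonneg hApos.le this
    have e : A * ((1 + (u + D) / 2) * ((u - D) / 2) ^ 2
        - (1 + (u + D) / 2 - ((u + D) / 2) ^ 2) * ((u - D) / 2)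
        + (1 - (u + D) / 2 + ((u + D) / 2) ^ 2) - β * ((u + D) / 2) * (1 - (u + D) / 2))
        = (A * D - β * (1 - u)) ^ 2 / 4
          + (A * K + ((1 - u) ^ 2 / 4) * (A * u - β ^ 2)) := by
      rw [hA, hK]; ring
    rw [e, hDA] at h3
    simpa using h3
  have hT2 : T ^ 2 ≤ (1 - u) ^ 2 / 4 := by
    rw [hT]; nlinarith
  have hmix : 0 ≤ A * K + T ^ 2 * (A * u - β ^ 2) := by
    rcases le_total 0 (A * u - β ^ 2) with h | h
    · have := mul_nonneg hApos.le hKnn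
      have := mul_nonneg (sq_nonneg T) h
      linarith
    · nlinarith
  have key : A * ((1 + a) * b ^ 2 - (1 + a - a ^ 2) * b + (1 - a + a ^ 2) - β * a * (1 - a)
      + s * (β * (a - b) - (1 - a - b) * (a + b)) + (a + b) * s ^ 2)
      = (A * (a - b) - 2 * β * T) ^ 2 / 4 + (A * K + T ^ 2 * (A * u - β ^ 2)) := by
    rw [hT, hA, hK, hu]; ring
  have : 0 ≤ A * ((1 + a) * b ^ 2 - (1 + a - a ^ 2) * b + (1 - a + a ^ 2) - β * a * (1 - a)
      + s * (β * (a - b) - (1 - a - b) * (a + b)) + (a + b) * s ^ 2) := by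
    rw [key]; positivity
  exact nonneg_of_mul_nonneg_right this hApos

/-- The determinant inequality, with `2` in place of `β`, when candidate `3` is never first: the
rankings `123`, `132`, `213`, `231` have shares proportional to `p`, `q`, `r`, `t`. -/
theorem two_mul_det_le_of_never_first {p q r t : ℝ} (hp : 0 ≤ p) (hq : 0 ≤ q) (hr : 0 ≤ r)
    (ht : 0 ≤ t) :
    2 * ((p + q) * (r + t + p) * t + (r + t) * q * (p + q + r)) ≤
      ((r + t + p) * t - p * q) * (r + t) + (q * (p + q + r) - t * r) * (p + q)
      + ((p + q) * (r + t + p) + r * (r + t)) * (p + q + r + t) := by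
  have h1 := mul_nonneg (add_nonneg hq ht) (sq_nonneg (q - t))
  have h2 := mul_nonneg hp (sq_nonneg (q - t))
  have h3 := mul_nonneg hr (sq_nonneg (q - t))
  nlinarith only [h1, h2, h3, mul_nonneg (mul_nonneg hr hq) ht, mul_nonneg (mul_nonneg hp hp) hq,
    mul_nonneg (mul_nonneg hp hp) hr, mul_nonneg (mul_nonneg hr hr) ht,
    mul_nonneg (mul_nonneg hr hr) hq, mul_nonneg (mul_nonneg hr hr) hp,
    mul_nonneg (mul_nonneg hp hp) hp, mul_nonneg (mul_nonneg hr hr) hr,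
    mul_nonneg (mul_nonneg hp hq) hq, mul_nonneg (mul_nonneg hp ht) ht,
    mul_nonneg (mul_nonneg hr hq) hq]

/-- The cubic in `s` is, up to sign, the discriminant in `a` of the gap treated in
`gap_nonneg_of_two_absent`. Its constant term `q0` vanishes at the optimal `b ≈ 0.424` for the
optimal `β`, and only `0 ≤ q0` can be used near there; below `b = 0.36` all coefficients have
explicit linear bounds. -/
theorem discriminant_nonneg {β : ℝ} (h1 : 1.949 ≤ β) (h2 : β ≤ 1.9494) {b s : ℝ}
    (hs : 0 ≤ s) (hsb : s ≤ b) (hb1 : b ≤ 1) {q0 q1 q2 : ℝ}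
    (hq0 : q0 = 3 + 2 * β - β ^ 2 - (2 + 6 * β) * b + (1 + 6 * β) * b ^ 2 + 6 * b ^ 3 - b ^ 4)
    (hq1 : q1 = 6 * b ^ 3 + (6 * β - 10) * b ^ 2 + (2 - 4 * β + 4 * β ^ 2) * b
      - 2 * β ^ 2 + 2 * β)
    (hq2 : q2 = 4 * β - β ^ 2 + (8 - 6 * β) * b - 9 * b ^ 2)
    (hq0nn : 0 ≤ q0) :
    0 ≤ q0 + s * q1 + s ^ 2 * q2 - 4 * (1 - b) * s ^ 3 := by
  have hb0 : 0 ≤ b := hs.trans hsb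
  have hβl : 3.7986 ≤ β ^ 2 := by nlinarith
  have hβu : β ^ 2 ≤ 3.8002 := by nlinarith
  have m1 := mul_nonneg hb0 (sub_nonneg.2 h2)
  have m2 := mul_nonneg hb0 (sub_nonneg.2 hβl)
  have m3 := mul_nonneg (sq_nonneg b) (sub_nonneg.2 h1)
  have hb3 : 0 ≤ b ^ 3 := by positivity
  have d1 : 6 * b ^ 3 + 1.694 * b ^ 2 + 9.3968 * b - 3.7024 ≤ q1 := by
    rw [hq1]; linarith
  have d2 : 3.9958 - 3.6964 * b - 9 * b ^ 2 ≤ q2 := by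
    rw [hq2]; linarith
  rcases le_total (9 / 25) b with hb | hb
  -- Here the cubic dominates `q0`: what remains is `s` times a function concave in `s`, which is
  -- nonnegative at the ends `s = 0` and `s = b`.
  · have e1 : 0 ≤ q1 := by nlinarith
    have e2 : 0 ≤ q1 + b * q2 - 4 * (1 - b) * b ^ 2 := by
      have h : q1 + b * q2 - 4 * (1 - b) * b ^ 2 =
          b ^ 3 - 6 * b ^ 2 + (2 + 3 * β ^ 2) * b - 2 * β ^ 2 + 2 * β := by
        rw [hq1, hq2]; ring
      rw [h]
      nlinarith [mul_nonneg (sub_nonneg.2 hb) (sub_nonneg.2 hb1)]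
    have e3 : 0 ≤ b * (q1 + s * q2 - 4 * (1 - b) * s ^ 2) := by
      have t1 := mul_nonneg (sub_nonneg.2 hsb) e1
      have t2 := mul_nonneg hs e2
      have t3 := mul_nonneg (mul_nonneg (mul_nonneg hs (sub_nonneg.2 hsb)) (sub_nonneg.2 hb1)) hb0
      have e : b * (q1 + s * q2 - 4 * (1 - b) * s ^ 2) = (b - s) * q1
          + s * (q1 + b * q2 - 4 * (1 - b) * b ^ 2) + 4 * (s * (b - s) * (1 - b) * b) := by ring
      rw [e]; linarith
    have e4 := nonneg_of_mul_nonneg_right e3 (by linarith)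
    have e5 := mul_nonneg hs e4
    have e : q0 + s * q1 + s ^ 2 * q2 - 4 * (1 - b) * s ^ 3
        = q0 + s * (q1 + s * q2 - 4 * (1 - b) * s ^ 2) := by ring
    rw [e]; linarith
  -- The line `1.37 - 3.68 * b` is close to the tangent of `q0` at `b = 0.325`.
  · have e0 : 1.37 - 3.68 * b ≤ q0 := by
      have t1 : 0 ≤ (b - 0.325) ^ 2 * (b + 0.65) := by positivity
      have t2 : 0 ≤ b ^ 3 * (9 / 25 - b) := mul_nonneg hb3 (sub_nonneg.2 hb)
      have t3 : 3.0978 - 13.6964 * b + 12.694 * b ^ 2 + 6 * b ^ 3 - b ^ 4 ≤ q0 := by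
        rw [hq0]; linarith
      have t4 := sq_nonneg (b - 0.3241)
      nlinarith only [t1, t2, t3, t4]
    have e1 : -3.705 + 9.5 * b ≤ q1 := by
      nlinarith only [d1, hb3, sq_nonneg (b - 0.031)]
    have e2 : 3.98 - 9.5 * b ≤ q2 - 4 * (1 - b) * b := by
      nlinarith only [d2, mul_nonneg hb0 (sub_nonneg.2 hb)]
    have e3 : 0 ≤ (1.37 - 3.68 * b) + s * (-3.705 + 9.5 * b) + s ^ 2 * (3.98 - 9.5 * b) := by
      have hd : (-3.705 + 9.5 * b) ^ 2 ≤ 4 * (1.37 - 3.68 * b) * (3.98 - 9.5 * b) := by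
        nlinarith only [mul_nonneg hb0 (sub_nonneg.2 hb), hb, hb0]
      have hp : 0 < 3.98 - 9.5 * b := by linarith
      have : 0 ≤ (3.98 - 9.5 * b) * ((1.37 - 3.68 * b) + s * (-3.705 + 9.5 * b)
          + s ^ 2 * (3.98 - 9.5 * b)) := by
        nlinarith only [sq_nonneg (2 * (3.98 - 9.5 * b) * s + (-3.705 + 9.5 * b)), hd]
      exact nonneg_of_mul_nonneg_right this hp
    have t1 := mul_nonneg hs (sub_nonneg.2 e1)
    have t2 := mul_nonneg (sq_nonneg s) (sub_nonneg.2 e2)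
    have t3 := mul_nonneg (mul_nonneg (sq_nonneg s) (sub_nonneg.2 hsb)) (sub_nonneg.2 hb1)
    nlinarith only [t1, t2, t3, e0, e3]

/-- The determinant inequality when the rankings `123` and `312` do not occur: `132`, `213`, `231`
have shares `a`, `s`, `b - s`, and `321` has the rest. The gap is a convex quadratic in `a`, whose
discriminant is controlled by `discriminant_nonneg`. -/
theorem gap_nonneg_of_two_absent {β : ℝ} (h1 : 1.949 ≤ β) (h2 : β ≤ 1.9494)
    (hH : Envelope β)
    (a : ℝ) {b s : ℝ} (hs : 0 ≤ s) (hsb : s ≤ b) (hb1 : b ≤ 1) :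
    0 ≤ (1 + a) * b ^ 2 - (1 + a - a ^ 2) * b + (1 - a + a ^ 2) - β * a * (1 - a)
      + s * (a * (1 - a) + (1 - b) * (a - b) - β * (1 - a - b)) + (1 - b) * s ^ 2 := by
  have hb0 : 0 ≤ b := hs.trans hsb
  obtain ⟨q0, hq0⟩ : ∃ q, q = 3 + 2 * β - β ^ 2 - (2 + 6 * β) * b + (1 + 6 * β) * b ^ 2 + 6 * b ^ 3
    - b ^ 4 := ⟨_, rfl⟩
  obtain ⟨q1, hq1⟩ : ∃ q, q = 6 * b ^ 3 + (6 * β - 10) * b ^ 2 + (2 - 4 * β + 4 * β ^ 2) * b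
    - 2 * β ^ 2 + 2 * β := ⟨_, rfl⟩
  obtain ⟨q2, hq2⟩ : ∃ q, q = 4 * β - β ^ 2 + (8 - 6 * β) * b - 9 * b ^ 2 := ⟨_, rfl⟩
  have hq0nn : 0 ≤ q0 := by
    have hA : 0 < 1 + b + β := by linarith
    obtain ⟨c, hc⟩ : ∃ c, c = (1 + β + b - b ^ 2) / (2 * (1 + b + β)) := ⟨_, rfl⟩
    have hcA : 2 * (1 + b + β) * c = 1 + β + b - b ^ 2 := by rw [hc]; field_simp
    have hc0 : 0 ≤ c := by rw [hc]; apply div_nonneg <;> nlinarith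
    have hc1 : c ≤ 1 := by rw [hc, div_le_iff₀ (by linarith)]; nlinarith
    have h3 := mul_nonneg hA.le (hH c b hc0 hc1)
    have e : 4 * ((1 + b + β) * ((1 + c) * b ^ 2 - (1 + c - c ^ 2) * b + (1 - c + c ^ 2)
        - β * c * (1 - c))) = (2 * (1 + b + β) * c - (1 + β + b - b ^ 2)) ^ 2 + q0 := by
      rw [hq0]; ring
    rw [hcA] at e
    linarith
  have hQ := discriminant_nonneg h1 h2 hs hsb hb1 hq0 hq1 hq2 hq0nn
  have hA : 0 < 1 + b + β - s := by linarith
  have key : 4 * ((1 + b + β - s) * ((1 + a) * b ^ 2 - (1 + a - a ^ 2) * b + (1 - a + a ^ 2)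
      - β * a * (1 - a) + s * (a * (1 - a) + (1 - b) * (a - b) - β * (1 - a - b))
      + (1 - b) * s ^ 2))
      = (2 * (1 + b + β - s) * a - (1 + β + b - b ^ 2 - s * (2 + β - b))) ^ 2
        + (q0 + s * q1 + s ^ 2 * q2 - 4 * (1 - b) * s ^ 3) := by
    rw [hq0, hq1, hq2]; ring
  have h4 : 0 ≤ 4 * ((1 + b + β - s) * ((1 + a) * b ^ 2 - (1 + a - a ^ 2) * b + (1 - a + a ^ 2)
      - β * a * (1 - a) + s * (a * (1 - a) + (1 - b) * (a - b) - β * (1 - a - b))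
      + (1 - b) * s ^ 2)) := by
    rw [key]; positivity
  exact nonneg_of_mul_nonneg_right (by linarith) hA

/-! ### The determinant inequality for shares of rankings -/

/-- With `x`, `y`, `z` the shares of voters preferring `1` to `2`, `2` to `3` and `3` to `1`, this
is the first entry of `𝟙ᵀ adj A`, where `A` is the matrix of pairwise shares (with zero diagonal);
the other entries arise by rotating the arguments. -/
def weight (x y z : ℝ) : ℝ := y * z + (1 - x) * (1 - y) - y * (1 - y)

/-- The shares `x`, `y`, `z` of voters preferring `1` to `2`, `2` to `3`, `3` to `1` and the
first-place shares `F₁`, `F₂`, `F₃` of an election. The six inequalities say that the share of each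
of the six rankings is nonnegative; for instance `x - F₁` is the share of `312`. -/
structure IsProfile (x y z F₁ F₂ F₃ : ℝ) : Prop where
  le₁₂ : F₁ ≤ x
  le₁₃ : F₁ ≤ 1 - z
  le₂₃ : F₂ ≤ y
  le₂₁ : F₂ ≤ 1 - x
  le₃₁ : F₃ ≤ z
  le₃₂ : F₃ ≤ 1 - y
  sum : F₁ + F₂ + F₃ = 1

theorem IsProfile.rotate {x y z F₁ F₂ F₃ : ℝ} (h : IsProfile x y z F₁ F₂ F₃) :
    IsProfile y z x F₂ F₃ F₁ :=
  ⟨h.le₂₃, h.le₂₁, h.le₃₁, h.le₃₂, h.le₁₂, h.le₁₃, by linarith [h.sum]⟩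

/-- If the weight of candidate `3` is the smallest, the right side only decreases when `F₁` and `F₂`
grow to their upper bounds. Two of the six rankings then disappear, which leaves four cases. -/
theorem det_le_of_weight_min {β : ℝ} (h1 : 1.949 ≤ β) (h2 : β ≤ 1.9494) (hH : Envelope β)
    {x y z F₁ F₂ F₃ : ℝ} (h : IsProfile x y z F₁ F₂ F₃)
    (hm1 : weight z x y ≤ weight x y z) (hm2 : weight z x y ≤ weight y z x) :
    β * (x * y * z + (1 - x) * (1 - y) * (1 - z)) ≤
      weight x y z * (1 - F₁) + weight y z x * (1 - F₂) + weight z x y * (1 - F₃) := by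
  obtain ⟨a1, a2, a3, a4, a5, a6, a7⟩ := h
  have red : ∀ G₁ G₂ : ℝ, F₁ ≤ G₁ → F₂ ≤ G₂ →
      weight x y z + weight y z x - (weight x y z - weight z x y) * G₁
        - (weight y z x - weight z x y) * G₂ ≤
      weight x y z * (1 - F₁) + weight y z x * (1 - F₂) + weight z x y * (1 - F₃) := by
    intro G₁ G₂ g1 g2
    have t1 := mul_nonneg (sub_nonneg.2 hm1) (sub_nonneg.2 g1)
    have t2 := mul_nonneg (sub_nonneg.2 hm2) (sub_nonneg.2 g2)
    have e : F₃ = 1 - F₁ - F₂ := by linarith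
    rw [e]; linarith
  rcases le_total x (1 - z) with hxz | hxz <;> rcases le_total y (1 - x) with hyx | hyx
  · refine le_trans ?_ (red x y a1 a3)
    have := gap_nonneg_of_two_absent h1 h2 hH x (b := y) (s := 1 - z - x) (by linarith)
      (by linarith) (by linarith)
    rw [← sub_nonneg]
    refine this.trans_eq ?_
    unfold weight; ring
  · refine le_trans ?_ (red x (1 - x) a1 a4)
    have := two_mul_det_le_of_never_first (p := y - (1 - x)) (q := 1 - y) (r := 1 - z - x)
      (t := z) (by linarith) (by linarith) (by linarith) (by linarith)
    have hd : 0 ≤ x * y * z + (1 - x) * (1 - y) * (1 - z) := by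
      have b1 : 0 ≤ x := by linarith
      have b2 : 0 ≤ y := by linarith
      have b3 : 0 ≤ z := by linarith
      have b4 : 0 ≤ 1 - x := by linarith
      have b5 : 0 ≤ 1 - y := by linarith
      have b6 : 0 ≤ 1 - z := by linarith
      positivity
    have h3 := mul_nonneg (sub_nonneg.2 (h2.trans (by norm_num : (1.9494:ℝ) ≤ 2))) hd
    unfold weight
    linarith
  · refine le_trans ?_ (red (1 - z) y a2 a3)
    have := gap_nonneg_of_never_last h1 h2 hH (a := 1 - z) (b := y) (s := x - (1 - z)) (by linarith)
      (by linarith) (by linarith) (by linarith)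
    rw [← sub_nonneg]
    refine this.trans_eq ?_
    unfold weight; ring
  -- The mirror image of the first case, with candidates `1` and `2` exchanged.
  · refine le_trans ?_ (red (1 - z) (1 - x) a2 a4)
    have := gap_nonneg_of_two_absent h1 h2 hH (1 - x) (b := 1 - z) (s := y - (1 - x)) (by linarith)
      (by linarith) (by linarith)
    rw [← sub_nonneg]
    refine this.trans_eq ?_
    unfold weight; ring

/-- The determinant inequality: `β * det A` is at most the weighted sum of the slacks `1 - Fᵢ`. -/
theorem det_le {β : ℝ} (h1 : 1.949 ≤ β) (h2 : β ≤ 1.9494) (hH : Envelope β)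
    {x y z F₁ F₂ F₃ : ℝ} (h : IsProfile x y z F₁ F₂ F₃) :
    β * (x * y * z + (1 - x) * (1 - y) * (1 - z)) ≤
      weight x y z * (1 - F₁) + weight y z x * (1 - F₂) + weight z x y * (1 - F₃) := by
  have k1 := det_le_of_weight_min h1 h2 hH h
  have k2 := det_le_of_weight_min h1 h2 hH h.rotate
  have k3 := det_le_of_weight_min h1 h2 hH h.rotate.rotate
  rcases le_total (weight x y z) (weight y z x) with h12 | h12 <;>
  rcases le_total (weight y z x) (weight z x y) with h23 | h23 <;>
  rcases le_total (weight z x y) (weight x y z) with h31 | h31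
  · linarith [k1 h31 (h31.trans h12)]
  · linarith [k2 h12 (h12.trans h23)]
  · linarith [k1 h31 h23]
  · linarith [k2 h12 h31]
  · linarith [k3 h23 h12]
  · linarith [k3 h23 h12]
  · linarith [k1 h31 h23]
  · linarith [k1 (h23.trans h12) h23]

/-- The weighted sum is positive even where `det A = 0`, that is where some candidate wins or loses
both pairwise comparisons unanimously. -/
theorem weighted_pos {β : ℝ} (h1 : 1.949 ≤ β) (h2 : β ≤ 1.9494) (hH : Envelope β)
    {x y z F₁ F₂ F₃ : ℝ} (h : IsProfile x y z F₁ F₂ F₃) :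
    0 < weight x y z * (1 - F₁) + weight y z x * (1 - F₂) + weight z x y * (1 - F₃) := by
  have hd := det_le h1 h2 hH h
  obtain ⟨a1, a2, a3, a4, a5, a6, a7⟩ := h
  have b1 : 0 ≤ x := by linarith
  have b2 : 0 ≤ y := by linarith
  have b3 : 0 ≤ z := by linarith
  have b4 : 0 ≤ 1 - x := by linarith
  have b5 : 0 ≤ 1 - y := by linarith
  have b6 : 0 ≤ 1 - z := by linarith
  have hp : 0 ≤ x * y * z := by positivity
  have hn : 0 ≤ (1 - x) * (1 - y) * (1 - z) := by positivity
  rcases lt_or_eq_of_le (add_nonneg hp hn) with hpos | hzero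
  · exact lt_of_lt_of_le (mul_pos (by linarith) hpos) hd
  have hp0 : x * y * z = 0 := by linarith
  have hn0 : (1 - x) * (1 - y) * (1 - z) = 0 := by linarith
  unfold weight
  simp only [mul_eq_zero] at hp0 hn0
  rcases hp0 with (h | h) | h <;> rcases hn0 with (h' | h') | h'
  · linarith
  · obtain rfl : y = 1 := by linarith
    subst h
    obtain rfl : F₁ = 0 := by linarith
    obtain rfl : F₃ = 0 := by linarith
    obtain rfl : F₂ = 1 := by linarith
    linarith
  · obtain rfl : z = 1 := by linarith
    subst h
    obtain rfl : F₁ = 0 := by linarith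
    nlinarith [mul_nonneg b2 b5]
  · obtain rfl : x = 1 := by linarith
    subst h
    obtain rfl : F₂ = 0 := by linarith
    nlinarith [mul_nonneg b3 b6]
  · linarith
  · obtain rfl : z = 1 := by linarith
    subst h
    obtain rfl : F₁ = 0 := by linarith
    obtain rfl : F₂ = 0 := by linarith
    obtain rfl : F₃ = 1 := by linarith
    linarith
  · obtain rfl : x = 1 := by linarith
    subst h
    obtain rfl : F₂ = 0 := by linarith
    obtain rfl : F₃ = 0 := by linarith
    obtain rfl : F₁ = 1 := by linarith
    linarith
  · obtain rfl : y = 1 := by linarith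
    subst h
    obtain rfl : F₃ = 0 := by linarith
    nlinarith [mul_nonneg b1 b4]
  · linarith

/-! ### A lottery with six linear constraints, by Helly's theorem in the plane -/

theorem helly_four {K D₁ D₂ D₃ : Set (ℝ × ℝ)} (hK : Convex ℝ K) (h₁ : Convex ℝ D₁)
    (h₂ : Convex ℝ D₂) (h₃ : Convex ℝ D₃) (i₁₂ : (K ∩ D₁ ∩ D₂).Nonempty)
    (i₂₃ : (K ∩ D₂ ∩ D₃).Nonempty) (i₁₃ : (K ∩ D₁ ∩ D₃).Nonempty)
    (i₁₂₃ : (D₁ ∩ D₂ ∩ D₃).Nonempty) : (K ∩ D₁ ∩ D₂ ∩ D₃).Nonempty := by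
  have h := Convex.helly_theorem (𝕜 := ℝ) (F := ![K, D₁, D₂, D₃]) (s := Finset.univ)
    (by simp) (by intro i _; fin_cases i <;> assumption) ?_
  · refine h.mono fun v hv => ?_
    simp only [Finset.mem_univ, Set.iInter_true, Set.mem_iInter] at hv
    exact ⟨⟨⟨hv 0, hv 1⟩, hv 2⟩, hv 3⟩
  · intro I _ hI
    have hc : (Iᶜ).card = 1 := by
      rw [Finset.card_compl, hI]; simp
    obtain ⟨j, hj⟩ := Finset.card_eq_one.1 hc
    have hmem : ∀ i ∈ I, i ≠ j := by
      rintro i hi rfl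
      exact Finset.mem_compl.1 (hj ▸ Finset.mem_singleton_self i) hi
    fin_cases j
    · refine i₁₂₃.mono fun v hv => Set.mem_iInter₂.2 fun i hi => ?_
      fin_cases i
      exacts [absurd rfl (hmem _ hi), hv.1.1, hv.1.2, hv.2]
    · refine i₂₃.mono fun v hv => Set.mem_iInter₂.2 fun i hi => ?_
      fin_cases i
      exacts [hv.1.1, absurd rfl (hmem _ hi), hv.1.2, hv.2]
    · refine i₁₃.mono fun v hv => Set.mem_iInter₂.2 fun i hi => ?_
      fin_cases i
      exacts [hv.1.1, hv.1.2, absurd rfl (hmem _ hi), hv.2]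
    · refine i₁₂.mono fun v hv => Set.mem_iInter₂.2 fun i hi => ?_
      fin_cases i
      exacts [hv.1.1, hv.1.2, hv.2, absurd rfl (hmem _ hi)]

/-- The half-plane `c₁ p₁ + c₂ p₂ + c₃ p₃ ≤ d` in the plane `p₁ + p₂ + p₃ = 1`, in the coordinates
`(p₁, p₂)`. -/
def halfPlane (c₁ c₂ c₃ d : ℝ) : Set (ℝ × ℝ) :=
  {v | c₁ * v.1 + c₂ * v.2 + c₃ * (1 - v.1 - v.2) ≤ d}

theorem convex_halfPlane (c₁ c₂ c₃ d : ℝ) : Convex ℝ (halfPlane c₁ c₂ c₃ d) := by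
  rintro ⟨a, b⟩ h ⟨a', b'⟩ h' s t hs ht hst
  simp only [halfPlane, Set.mem_ofPred_eq, Prod.smul_mk, Prod.mk_add_mk, smul_eq_mul] at *
  have t1 := mul_le_mul_of_nonneg_left h hs
  have t2 := mul_le_mul_of_nonneg_left h' ht
  obtain rfl : s = 1 - t := by linarith
  linarith

/-- A lottery between two candidates only, proportional to the squares of their pairwise shares. -/
theorem exists_duel {β x : ℝ} (h2 : β ≤ 2) (hx0 : 0 ≤ x) (hx1 : x ≤ 1) :
    ∃ p q : ℝ, 0 ≤ p ∧ 0 ≤ q ∧ p + q = 1 ∧ β * p * (1 - x) ≤ x ∧ β * q * x ≤ 1 - x := by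
  have hpos : 0 < x ^ 2 + (1 - x) ^ 2 := by nlinarith [sq_nonneg (x - 1 / 2)]
  have hle : β * x * (1 - x) ≤ x ^ 2 + (1 - x) ^ 2 := by
    nlinarith [sq_nonneg (2 * x - 1), mul_nonneg hx0 (sub_nonneg.2 hx1)]
  refine ⟨x ^ 2 / (x ^ 2 + (1 - x) ^ 2), (1 - x) ^ 2 / (x ^ 2 + (1 - x) ^ 2), by positivity,
    by positivity, by field_simp, ?_, ?_⟩
  · have := mul_le_mul_of_nonneg_left hle hx0
    rw [mul_div_assoc', div_mul_eq_mul_div, div_le_iff₀ hpos]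
    linarith
  · have := mul_le_mul_of_nonneg_left hle (sub_nonneg.2 hx1)
    rw [mul_div_assoc', div_mul_eq_mul_div, div_le_iff₀ hpos]
    linarith

/-- A point of the plane `p₁ + p₂ + p₃ = 1`, not necessarily with nonnegative coordinates, for the
three first-place constraints: the normalization of `adj A` applied to `(1 - F₁, 1 - F₂, 1 - F₃)`.
The normalizing sum is at least `β * det A` by `det_le`. -/
theorem exists_balanced {β : ℝ} (h1 : 1.949 ≤ β) (h2 : β ≤ 1.9494) (hH : Envelope β)
    {x y z F₁ F₂ F₃ : ℝ} (h : IsProfile x y z F₁ F₂ F₃) :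
    ∃ p₁ p₂ p₃ : ℝ, p₁ + p₂ + p₃ = 1 ∧
      β * (p₂ * x + p₃ * (1 - z)) ≤ 1 - F₁ ∧ β * (p₁ * (1 - x) + p₃ * y) ≤ 1 - F₂ ∧
      β * (p₁ * z + p₂ * (1 - y)) ≤ 1 - F₃ := by
  have hd := det_le h1 h2 hH h
  have hS := weighted_pos h1 h2 hH h
  obtain ⟨S, hSdef⟩ : ∃ S, S = weight x y z * (1 - F₁) + weight y z x * (1 - F₂)
    + weight z x y * (1 - F₃) := ⟨_, rfl⟩
  rw [← hSdef] at hd hS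
  obtain ⟨a1, a2, a3, a4, a5, a6, a7⟩ := h
  refine ⟨(-(y * (1 - y)) * (1 - F₁) + (1 - y) * (1 - z) * (1 - F₂) + x * y * (1 - F₃)) / S,
    (y * z * (1 - F₁) + -(z * (1 - z)) * (1 - F₂) + (1 - x) * (1 - z) * (1 - F₃)) / S,
    ((1 - x) * (1 - y) * (1 - F₁) + x * z * (1 - F₂) + -(x * (1 - x)) * (1 - F₃)) / S,
    ?_, ?_, ?_, ?_⟩
  · rw [← add_div, ← add_div, div_eq_one_iff_eq hS.ne', hSdef]
    unfold weight; ring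
  · have := mul_le_mul_of_nonneg_right hd (by linarith : 0 ≤ 1 - F₁)
    rw [div_mul_eq_mul_div, div_mul_eq_mul_div, ← add_div, mul_div_assoc', div_le_iff₀ hS]
    linarith
  · have := mul_le_mul_of_nonneg_right hd (by linarith : 0 ≤ 1 - F₂)
    rw [div_mul_eq_mul_div, div_mul_eq_mul_div, ← add_div, mul_div_assoc', div_le_iff₀ hS]
    linarith
  · have := mul_le_mul_of_nonneg_right hd (by linarith : 0 ≤ 1 - F₃)
    rw [div_mul_eq_mul_div, div_mul_eq_mul_div, ← add_div, mul_div_assoc', div_le_iff₀ hS]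
    linarith

/-- Helly's theorem for the set of lotteries with the three last-place constraints and the three
half-planes of the first-place constraints: `exists_duel` meets the former together with any two of
the latter, and `exists_balanced` meets all three half-planes. -/
theorem exists_lottery {β : ℝ} (h1 : 1.949 ≤ β) (h2 : β ≤ 1.9494) (hH : Envelope β)
    {x y z F₁ F₂ F₃ L₁ L₂ L₃ : ℝ} (h : IsProfile x y z F₁ F₂ F₃)
    (l₂₁ : L₁ ≤ 1 - x) (l₃₁ : L₁ ≤ z) (l₁₂ : L₂ ≤ x) (l₃₂ : L₂ ≤ 1 - y)
    (l₁₃ : L₃ ≤ 1 - z) (l₂₃ : L₃ ≤ y) :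
    ∃ p₁ p₂ p₃ : ℝ, 0 ≤ p₁ ∧ 0 ≤ p₂ ∧ 0 ≤ p₃ ∧ p₁ + p₂ + p₃ = 1 ∧
      β * (p₁ * L₁) ≤ 1 - L₁ ∧ β * (p₂ * L₂) ≤ 1 - L₂ ∧ β * (p₃ * L₃) ≤ 1 - L₃ ∧
      β * (p₂ * x + p₃ * (1 - z)) ≤ 1 - F₁ ∧ β * (p₁ * (1 - x) + p₃ * y) ≤ 1 - F₂ ∧
      β * (p₁ * z + p₂ * (1 - y)) ≤ 1 - F₃ := by
  have hβ : 0 ≤ β := by linarith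
  have hβ2 : β ≤ 2 := by linarith
  obtain ⟨r₁, r₂, r₃, hr, e₁, e₂, e₃⟩ := exists_balanced h1 h2 hH h
  obtain ⟨a1, a2, a3, a4, a5, a6, a7⟩ := h
  obtain ⟨p, q, hp, hq, hpq, hpx, hqx⟩ := exists_duel hβ2 (x := x) (by linarith) (by linarith)
  obtain ⟨p', q', hp', hq', hpq', hpy, hqy⟩ :=
    exists_duel hβ2 (x := y) (by linarith) (by linarith)
  obtain ⟨p'', q'', hp'', hq'', hpq'', hpz, hqz⟩ :=
    exists_duel hβ2 (x := z) (by linarith) (by linarith)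
  have mono : ∀ {p u v : ℝ}, 0 ≤ p → u ≤ v → β * p * u ≤ β * p * v := fun hp huv =>
    mul_le_mul_of_nonneg_left huv (mul_nonneg hβ hp)
  obtain ⟨⟨u, v⟩, hK, hrest⟩ := helly_four
    (K := halfPlane (-1) 0 0 0 ∩ (halfPlane 0 (-1) 0 0 ∩ (halfPlane 0 0 (-1) 0 ∩
      (halfPlane (β * L₁) 0 0 (1 - L₁) ∩ (halfPlane 0 (β * L₂) 0 (1 - L₂) ∩
        halfPlane 0 0 (β * L₃) (1 - L₃))))))
    (D₁ := halfPlane 0 (β * x) (β * (1 - z)) (1 - F₁))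
    (D₂ := halfPlane (β * (1 - x)) 0 (β * y) (1 - F₂))
    (D₃ := halfPlane (β * z) (β * (1 - y)) 0 (1 - F₃))
    (by
      repeat' first
        | exact convex_halfPlane _ _ _ _
        | refine Convex.inter ?_ ?_)
    (convex_halfPlane _ _ _ _) (convex_halfPlane _ _ _ _) (convex_halfPlane _ _ _ _)
    (by
      obtain rfl : q = 1 - p := by linarith
      have m1 := mono hp l₂₁
      have m2 := mono hq l₁₂
      refine ⟨(p, 1 - p), ⟨⟨?_, ?_, ?_, ?_, ?_, ?_⟩, ?_⟩, ?_⟩ <;>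
        simp only [halfPlane, Set.mem_ofPred_eq] <;> linarith)
    (by
      obtain rfl : q' = 1 - p' := by linarith
      have m1 := mono hp' l₃₂
      have m2 := mono hq' l₂₃
      refine ⟨(0, p'), ⟨⟨?_, ?_, ?_, ?_, ?_, ?_⟩, ?_⟩, ?_⟩ <;>
        simp only [halfPlane, Set.mem_ofPred_eq] <;> linarith)
    (by
      obtain rfl : q'' = 1 - p'' := by linarith
      have m1 := mono hp'' l₁₃
      have m2 := mono hq'' l₃₁
      refine ⟨(1 - p'', 0), ⟨⟨?_, ?_, ?_, ?_, ?_, ?_⟩, ?_⟩, ?_⟩ <;>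
        simp only [halfPlane, Set.mem_ofPred_eq] <;> linarith)
    (by
      obtain rfl : r₃ = 1 - r₁ - r₂ := by linarith
      refine ⟨(r₁, r₂), ⟨?_, ?_⟩, ?_⟩ <;>
        simp only [halfPlane, Set.mem_ofPred_eq] <;> linarith)
  obtain ⟨⟨⟨k₁, k₂, k₃, k₄, k₅, k₆⟩, d₁⟩, d₂⟩ := hK
  simp only [halfPlane, Set.mem_ofPred_eq] at k₁ k₂ k₃ k₄ k₅ k₆ d₁ d₂ hrest
  refine ⟨u, v, 1 - u - v, ?_, ?_, ?_, ?_, ?_, ?_, ?_, ?_, ?_, ?_⟩ <;> linarith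

/-! ### From the six constraints to distortion -/

/-- The average over the voters. -/
noncomputable def avg {n : ℕ} (g : Fin n → ℝ) : ℝ := (1 / (n : ℝ)) * ∑ v, g v

theorem avg_mono {n : ℕ} {g h : Fin n → ℝ} (H : ∀ v, g v ≤ h v) : avg g ≤ avg h :=
  mul_le_mul_of_nonneg_left (Finset.sum_le_sum fun v _ => H v) (by positivity)

theorem avg_add {n : ℕ} (g h : Fin n → ℝ) : avg (fun v => g v + h v) = avg g + avg h := by
  simp only [avg, Finset.sum_add_distrib, mul_add]

theorem avg_sub {n : ℕ} (g h : Fin n → ℝ) : avg (fun v => g v - h v) = avg g - avg h := by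
  simp only [avg, Finset.sum_sub_distrib, mul_sub]

theorem avg_const_mul {n : ℕ} (c : ℝ) (g : Fin n → ℝ) :
    avg (fun v => c * g v) = c * avg g := by
  simp only [avg, ← Finset.mul_sum]; ring

theorem avg_const {n : ℕ} (hn : 0 < n) (c : ℝ) : avg (fun _ : Fin n => c) = c := by
  have : (n : ℝ) ≠ 0 := by positivity
  simp [avg, this]

/-- Indicator of `v` preferring `i` to `j`. -/
noncomputable def pref {n : ℕ} (σ : Election n 3) (i j : Fin 3) (v : Fin n) : ℝ :=
  if (σ v).symm i < (σ v).symm j then 1 else 0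

/-- Indicator of `v` ranking `i` first. -/
noncomputable def top {n : ℕ} (σ : Election n 3) (i : Fin 3) (v : Fin n) : ℝ :=
  if (σ v).symm i = 0 then 1 else 0

/-- Indicator of `v` ranking `i` last. -/
noncomputable def bot {n : ℕ} (σ : Election n 3) (i : Fin 3) (v : Fin n) : ℝ :=
  if (σ v).symm i = 2 then 1 else 0

theorem pref_add_pref {n : ℕ} (σ : Election n 3) {i j : Fin 3} (h : i ≠ j) (v : Fin n) :
    pref σ i j v + pref σ j i v = 1 := by
  unfold pref
  rcases lt_or_gt_of_ne ((σ v).symm.injective.ne h) with h | h <;> simp [h, h.not_gt]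

theorem top_le_pref {n : ℕ} (σ : Election n 3) {i j : Fin 3} (h : i ≠ j) (v : Fin n) :
    top σ i v ≤ pref σ i j v := by
  have := (σ v).symm.injective.ne h
  unfold top pref
  split_ifs <;> first | omega | norm_num

theorem bot_le_pref {n : ℕ} (σ : Election n 3) {i j : Fin 3} (h : i ≠ j) (v : Fin n) :
    bot σ i v ≤ pref σ j i v := by
  have := (σ v).symm.injective.ne h
  unfold bot pref
  split_ifs <;> first | omega | norm_num

theorem top_sum {n : ℕ} (σ : Election n 3) (v : Fin n) :
    top σ 0 v + top σ 1 v + top σ 2 v = 1 := by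
  have h1 := (σ v).symm.injective.ne (show (0 : Fin 3) ≠ 1 by decide)
  have h2 := (σ v).symm.injective.ne (show (0 : Fin 3) ≠ 2 by decide)
  have h3 := (σ v).symm.injective.ne (show (1 : Fin 3) ≠ 2 by decide)
  unfold top
  split_ifs <;> first | omega | norm_num

section Biased

variable {n : ℕ} {σ : Election n 3} {d : HiddenMetric n 3}

theorem candDist_nonneg (i : Fin 3) (v : Fin n) : 0 ≤ candDist d i v :=
  @dist_nonneg _ d _ _

theorem candDist_le (i k : Fin 3) (v : Fin n) :
    candDist d i v ≤ d.dist (Sum.inr i) (Sum.inr k) + candDist d k v :=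
  @dist_triangle _ d _ _ _

theorem dist_le_candDist (i k : Fin 3) (v : Fin n) :
    d.dist (Sum.inr i) (Sum.inr k) ≤ candDist d i v + candDist d k v := by
  have := @dist_triangle_right _ d (Sum.inr i) (Sum.inr k) (Sum.inl v)
  exact this

/-- The distances of voter `v` in terms of the distances `X` and `Y` of `i` and `j` from `k`. For
`X ≤ Y` the bounds are nonnegative combinations of the two extreme cases in which only `j`, or both
`i` and `j`, are far from `k`. -/
theorem voter_bounds (hd : Consistent d σ) {k i j : Fin 3} (hki : k ≠ i) (hkj : k ≠ j)
    (hij : i ≠ j) {X Y : ℝ} (hX : X = d.dist (Sum.inr i) (Sum.inr k))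
    (hY : Y = d.dist (Sum.inr j) (Sum.inr k)) (v : Fin n) :
    candDist d i v - candDist d k v ≤ X * pref σ k i v ∧
    candDist d j v - candDist d k v ≤ X * pref σ k j v + (Y - X) * bot σ j v ∧
    X * (1 - top σ k v) + (Y - X) * (1 - bot σ j v) ≤ 2 * candDist d k v := by
  have n1 := (σ v).symm.injective.ne hki
  have n2 := (σ v).symm.injective.ne hkj
  have n3 := (σ v).symm.injective.ne hij
  have c1 := hd v
  unfold Prefers at c1
  have t1 := candDist_le (d := d) i k v
  have t2 := candDist_le (d := d) j k v
  have t3 := dist_le_candDist (d := d) i k v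
  have t4 := dist_le_candDist (d := d) j k v
  have t5 := candDist_nonneg (d := d) k v
  rw [← hX] at t1 t3
  rw [← hY] at t2 t4
  unfold pref top bot
  rcases lt_or_gt_of_ne n1 with h1 | h1 <;> rcases lt_or_gt_of_ne n2 with h2 | h2 <;>
    rcases lt_or_gt_of_ne n3 with h3 | h3 <;>
    have g1 := c1 _ _ h1 <;> have g2 := c1 _ _ h2 <;> have g3 := c1 _ _ h3 <;>
    split_ifs <;> first | omega | (refine ⟨?_, ?_, ?_⟩ <;> linarith)

/-- One last-place and one first-place constraint bound the expected regret relative to `k`, when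
`j` is at least as far from `k` as `i` is. -/
theorem regret_le (hn : 0 < n) (hd : Consistent d σ) {β : ℝ} (hβ : 0 ≤ β) {p q : ℝ}
    (hp : 0 ≤ p) (hq : 0 ≤ q) {k i j : Fin 3} (hki : k ≠ i) (hkj : k ≠ j) (hij : i ≠ j)
    (hC : β * (q * avg (bot σ j)) ≤ 1 - avg (bot σ j))
    (hD : β * (p * avg (pref σ k i) + q * avg (pref σ k j)) ≤ 1 - avg (top σ k))
    (hXY : d.dist (Sum.inr i) (Sum.inr k) ≤ d.dist (Sum.inr j) (Sum.inr k)) :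
    β * (p * (socialCost d i - socialCost d k) + q * (socialCost d j - socialCost d k)) ≤
      2 * socialCost d k := by
  obtain ⟨X, hX⟩ : ∃ X, X = d.dist (Sum.inr i) (Sum.inr k) := ⟨_, rfl⟩
  obtain ⟨Y, hY⟩ : ∃ Y, Y = d.dist (Sum.inr j) (Sum.inr k) := ⟨_, rfl⟩
  rw [← hX, ← hY] at hXY
  have hX0 : 0 ≤ X := hX ▸ @dist_nonneg _ d _ _
  have b := voter_bounds hd hki hkj hij hX hY
  have b1 := avg_mono fun v => (b v).1
  have b2 := avg_mono fun v => (b v).2.1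
  have b3 := avg_mono fun v => (b v).2.2
  simp only [avg_sub, avg_add, avg_const_mul, avg_const hn] at b1 b2 b3
  have e : ∀ l, socialCost d l = avg (candDist d l) := fun l => rfl
  rw [e, e, e]
  have s1 := mul_le_mul_of_nonneg_left b1 (mul_nonneg hβ hp)
  have s2 := mul_le_mul_of_nonneg_left b2 (mul_nonneg hβ hq)
  have s3 := mul_le_mul_of_nonneg_left hD hX0
  have s4 := mul_le_mul_of_nonneg_left hC (sub_nonneg.2 hXY)
  linarith

end Biased

theorem exists_lottery_le {β : ℝ} (h1 : 1.949 ≤ β) (h2 : β ≤ 1.9494) (hH : Envelope β)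
    {n : ℕ} (hn : 0 < n) (σ : Election n 3) :
    ∃ p : Lottery 3, lotteryDistortion σ p ≤ ENNReal.ofReal (1 + 2 / β) := by
  have hβ : 0 < β := by linarith
  have cpl : ∀ i j : Fin 3, i ≠ j → avg (pref σ j i) = 1 - avg (pref σ i j) := by
    intro i j h
    have := avg_add (pref σ i j) (pref σ j i)
    simp only [pref_add_pref σ h, avg_const hn] at this
    linarith
  have htop : ∀ i j : Fin 3, i ≠ j → avg (top σ i) ≤ avg (pref σ i j) := fun i j h =>
    avg_mono (top_le_pref σ h)
  have hbot : ∀ i j : Fin 3, i ≠ j → avg (bot σ i) ≤ avg (pref σ j i) := fun i j h =>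
    avg_mono (bot_le_pref σ h)
  have hsum : avg (top σ 0) + avg (top σ 1) + avg (top σ 2) = 1 := by
    rw [← avg_add, ← avg_add]
    simp only [top_sum, avg_const hn]
  have e10 := cpl 0 1 (by decide)
  have e21 := cpl 1 2 (by decide)
  have e02 := cpl 2 0 (by decide)
  obtain ⟨p₁, p₂, p₃, hp₁, hp₂, hp₃, hp, C₁, C₂, C₃, D₁, D₂, D₃⟩ := exists_lottery h1 h2 hH
    (x := avg (pref σ 0 1)) (y := avg (pref σ 1 2)) (z := avg (pref σ 2 0))
    (F₁ := avg (top σ 0)) (F₂ := avg (top σ 1)) (F₃ := avg (top σ 2))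
    (L₁ := avg (bot σ 0)) (L₂ := avg (bot σ 1)) (L₃ := avg (bot σ 2))
    ⟨htop 0 1 (by decide), e02 ▸ htop 0 2 (by decide), htop 1 2 (by decide),
      e10 ▸ htop 1 0 (by decide), htop 2 0 (by decide), e21 ▸ htop 2 1 (by decide), hsum⟩
    (e10 ▸ hbot 0 1 (by decide)) (hbot 0 2 (by decide)) (hbot 1 0 (by decide))
    (e21 ▸ hbot 1 2 (by decide)) (e02 ▸ hbot 2 0 (by decide)) (hbot 2 1 (by decide))
  rw [← e02] at D₁
  rw [← e10] at D₂
  rw [← e21] at D₃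
  have hpnn : ∀ i, 0 ≤ (![p₁, p₂, p₃] : Fin 3 → ℝ) i := by
    intro i; fin_cases i <;> assumption
  refine ⟨⟨![p₁, p₂, p₃], hpnn, ?_⟩, iSup₂_le fun d hd => ?_⟩
  · simpa [Fin.sum_univ_three] using hp
  obtain ⟨k, hk⟩ := exists_eq_ciInf_of_finite (f := fun j => socialCost d j)
  unfold approxRatio
  rw [← hk]
  apply ENNReal.div_le_of_le_mul
  rw [← ENNReal.ofReal_mul (by positivity)]
  apply ENNReal.ofReal_le_ofReal
  have main : β * (expectedCost d ⟨![p₁, p₂, p₃], hpnn, by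
      simpa [Fin.sum_univ_three] using hp⟩ - socialCost d k) ≤ 2 * socialCost d k := by
    simp only [expectedCost, Fin.sum_univ_three]
    have tot : socialCost d k = (p₁ + p₂ + p₃) * socialCost d k := by rw [hp, one_mul]
    have main : β * (p₁ * (socialCost d 0 - socialCost d k) + p₂ * (socialCost d 1 - socialCost d k)
        + p₃ * (socialCost d 2 - socialCost d k)) ≤ 2 * socialCost d k := by
      have swap : ∀ {a b c : ℝ}, β * (a + b) ≤ c → β * (b + a) ≤ c := fun h => by
        rwa [add_comm]
      fin_cases k
      · have r : β * (p₂ * (socialCost d 1 - socialCost d 0)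
            + p₃ * (socialCost d 2 - socialCost d 0)) ≤ 2 * socialCost d 0 := by
          rcases le_total (d.dist (Sum.inr 1) (Sum.inr 0)) (d.dist (Sum.inr 2) (Sum.inr 0))
            with h | h
          · exact regret_le (k := 0) (i := 1) (j := 2) hn hd hβ.le hp₂ hp₃
              (by decide) (by decide) (by decide) C₃ D₁ h
          · exact swap (regret_le (k := 0) (i := 2) (j := 1) hn hd hβ.le hp₃ hp₂
              (by decide) (by decide) (by decide) C₂ (swap D₁) h)
        simpa using r
      · have r : β * (p₁ * (socialCost d 0 - socialCost d 1)
            + p₃ * (socialCost d 2 - socialCost d 1)) ≤ 2 * socialCost d 1 := by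
          rcases le_total (d.dist (Sum.inr 0) (Sum.inr 1)) (d.dist (Sum.inr 2) (Sum.inr 1))
            with h | h
          · exact regret_le (k := 1) (i := 0) (j := 2) hn hd hβ.le hp₁ hp₃
              (by decide) (by decide) (by decide) C₃ D₂ h
          · exact swap (regret_le (k := 1) (i := 2) (j := 0) hn hd hβ.le hp₃ hp₁
              (by decide) (by decide) (by decide) C₁ (swap D₂) h)
        simpa using r
      · have r : β * (p₁ * (socialCost d 0 - socialCost d 2)
            + p₂ * (socialCost d 1 - socialCost d 2)) ≤ 2 * socialCost d 2 := by
          rcases le_total (d.dist (Sum.inr 0) (Sum.inr 2)) (d.dist (Sum.inr 1) (Sum.inr 2))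
            with h | h
          · exact regret_le (k := 2) (i := 0) (j := 1) hn hd hβ.le hp₁ hp₂
              (by decide) (by decide) (by decide) C₂ D₃ h
          · exact swap (regret_le (k := 2) (i := 1) (j := 0) hn hd hβ.le hp₂ hp₁
              (by decide) (by decide) (by decide) C₁ (swap D₃) h)
        simpa using r
    change β * (p₁ * socialCost d 0 + p₂ * socialCost d 1 + p₃ * socialCost d 2
      - socialCost d k) ≤ 2 * socialCost d k
    refine le_of_eq_of_le ?_ main
    linear_combination (-β) * tot
  have : expectedCost d ⟨![p₁, p₂, p₃], hpnn, by
      simpa [Fin.sum_univ_three] using hp⟩ - socialCost d k ≤ 2 * socialCost d k / β := by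
    rw [le_div_iff₀ hβ]; linarith
  have e : (1 + 2 / β) * socialCost d k = socialCost d k + 2 * socialCost d k / β := by ring
  rw [e]
  linarith

/-! ### The minimum of `beta` -/

/-- The minimum over `0 < a < 1` of the function obtained from `beta` by minimizing over `b`. It is
attained in `[2/5, 3/5]`, because outside this interval the function exceeds its value at
`1 / 2`. -/
theorem exists_threshold : ∃ a β : ℝ, 2 / 5 ≤ a ∧ a ≤ 3 / 5 ∧
    4 * β * a * (1 - a ^ 2) = 3 - 2 * a + a ^ 2 + 6 * a ^ 3 - a ^ 4 ∧
    ∀ c : ℝ, 0 ≤ c → c ≤ 1 →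
      4 * β * c * (1 - c ^ 2) ≤ 3 - 2 * c + c ^ 2 + 6 * c ^ 3 - c ^ 4 := by
  have den : ∀ c : ℝ, 0 < c → c < 1 → 0 < 4 * c * (1 - c ^ 2) := fun c h0 h1 =>
    mul_pos (by linarith) (by nlinarith)
  have hcont : ContinuousOn (fun c : ℝ => (3 - 2 * c + c ^ 2 + 6 * c ^ 3 - c ^ 4)
      / (4 * c * (1 - c ^ 2))) (Set.Icc (2 / 5) (3 / 5)) := by
    apply ContinuousOn.div (by fun_prop) (by fun_prop)
    intro c hc
    exact (den c (by linarith [hc.1]) (by linarith [hc.2])).ne'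
  obtain ⟨a, ha, hmin⟩ := isCompact_Icc.exists_isMinOn
    (Set.nonempty_Icc.2 (by norm_num : (2 / 5 : ℝ) ≤ 3 / 5)) hcont
  have hda := den a (by linarith [ha.1]) (by linarith [ha.2])
  refine ⟨a, (3 - 2 * a + a ^ 2 + 6 * a ^ 3 - a ^ 4) / (4 * a * (1 - a ^ 2)), ha.1, ha.2, ?_, ?_⟩
  · rw [← div_mul_cancel₀ (3 - 2 * a + a ^ 2 + 6 * a ^ 3 - a ^ 4) hda.ne']
    simp only [mul_div_cancel_right₀ _ hda.ne']
    ring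
  · intro c hc0 hc1
    have hhalf := hmin (show (1 / 2 : ℝ) ∈ Set.Icc (2 / 5 : ℝ) (3 / 5) by
      constructor <;> norm_num)
    simp only [Set.mem_ofPred_eq] at hhalf
    obtain ⟨β, hβ⟩ : ∃ β, β = (3 - 2 * a + a ^ 2 + 6 * a ^ 3 - a ^ 4) / (4 * a * (1 - a ^ 2)) :=
      ⟨_, rfl⟩
    rw [← hβ] at hhalf ⊢
    -- The value at `1 / 2` is `47 / 24 < 1.96`.
    have hβ' : β ≤ 1.96 := hhalf.trans (by norm_num)
    have hc : 0 ≤ 4 * c * (1 - c ^ 2) := mul_nonneg (by linarith) (by nlinarith)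
    have hup := mul_le_mul_of_nonneg_right hβ' hc
    rcases le_total c (2 / 5) with h | h
    · have h3 : 0 ≤ c ^ 3 := by positivity
      nlinarith [mul_nonneg (sub_nonneg.2 h) (sub_nonneg.2 h), mul_nonneg h3 (sub_nonneg.2 hc1),
        mul_nonneg hc0 (sq_nonneg (c - 2 / 5))]
    rcases le_total c (3 / 5) with h' | h'
    · have := hmin (show c ∈ Set.Icc (2 / 5 : ℝ) (3 / 5) from ⟨h, h'⟩)
      simp only [Set.mem_ofPred_eq] at this
      rw [← hβ, le_div_iff₀ (den c (by linarith) (by linarith))] at this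
      linarith
    · have h3 : 0 ≤ c ^ 3 := by positivity
      nlinarith [mul_nonneg h3 (sub_nonneg.2 hc1), mul_nonneg hc0 (sq_nonneg (c - 3 / 5)),
        sq_nonneg (c - 3 / 5)]

theorem threshold_bounds {a β : ℝ} (ha : 2 / 5 ≤ a) (ha' : a ≤ 3 / 5)
    (he : 4 * β * a * (1 - a ^ 2) = 3 - 2 * a + a ^ 2 + 6 * a ^ 3 - a ^ 4)
    (hle : ∀ c : ℝ, 0 ≤ c → c ≤ 1 →
      4 * β * c * (1 - c ^ 2) ≤ 3 - 2 * c + c ^ 2 + 6 * c ^ 3 - c ^ 4) :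
    1.949072 ≤ β ∧ β ≤ 1.94908 := by
  constructor
  · have hp : 0 ≤ 3 - 2 * a + a ^ 2 + 6 * a ^ 3 - a ^ 4 - 4 * 1.949072 * a * (1 - a ^ 2) := by
      -- The minimizer is `0.473356` up to an error below `10⁻⁶`.
      obtain ⟨t, rfl⟩ : ∃ t, a = 0.47336 + t := ⟨a - 0.47336, by ring⟩
      have ht : 0 ≤ 11 * t ^ 3 + 2 * t ^ 2 - t ^ 4 := by
        have : 0 ≤ 11 * t + 2 - t ^ 2 := by nlinarith
        nlinarith [mul_nonneg (sq_nonneg t) this]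
      nlinarith [sq_nonneg (t + 0.00001), mul_nonneg (sq_nonneg t) (by linarith : 0 ≤ t + 0.1)]
    have hpos : 0 < 4 * a * (1 - a ^ 2) := mul_pos (by linarith) (by nlinarith)
    by_contra! h
    nlinarith [mul_lt_mul_of_pos_right h hpos]
  · have := hle 0.4734 (by norm_num) (by norm_num)
    norm_num at this ⊢
    linarith

theorem beta_eq {a b : ℝ} (h0 : 0 < a) (h1 : a < 1) :
    beta (a, b) = ((1 + a) * b ^ 2 - (1 + a - a ^ 2) * b + (1 - a + a ^ 2)) / (a * (1 - a)) := by
  have : 1 - a ≠ 0 := by linarith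
  unfold beta
  field_simp
  ring

theorem exists_optimum : ∃ x₀ : ℝ × ℝ, x₀ ∈ admissible ∧ x₀.1 + x₀.2 < 1 ∧
    IsMinOn beta admissible x₀ ∧ Envelope (beta x₀) ∧
    1.949072 ≤ beta x₀ ∧ beta x₀ ≤ 1.94908 := by
  obtain ⟨a, β, ha, ha', he, hle⟩ := exists_threshold
  have hb := threshold_bounds ha ha' he hle
  have hE : Envelope β := fun a b h0 h1 => envelope_nonneg b h0 (by linarith [hle a h0 h1])
  have hβ : beta (a, (1 + a - a ^ 2) / (2 * (1 + a))) = β := by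
    rw [beta_eq (by linarith) (by linarith), div_eq_iff (by nlinarith)]
    field_simp
    nlinarith
  have b0 : 0 < (1 + a - a ^ 2) / (2 * (1 + a)) := div_pos (by nlinarith) (by linarith)
  have b1 : (1 + a - a ^ 2) / (2 * (1 + a)) < 1 / 2 := by
    rw [div_lt_iff₀ (by linarith)]; nlinarith
  have b2 : (1 + a - a ^ 2) / (2 * (1 + a)) < 1 - a := by
    rw [div_lt_iff₀ (by linarith)]; nlinarith
  refine ⟨(a, (1 + a - a ^ 2) / (2 * (1 + a))), ?_, ?_, ?_, hβ.symm ▸ hE, hβ.symm ▸ hb.1,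
    hβ.symm ▸ hb.2⟩
  · refine ⟨?_, ?_, b0, b1, ?_, ?_⟩ <;> dsimp only
    · linarith
    · linarith
    · linarith
    · rw [div_lt_one (by linarith)]; nlinarith
  · dsimp only; linarith
  · rintro ⟨c, b⟩ ⟨h0, h1, -⟩
    dsimp only at h0 h1
    simp only [Set.mem_ofPred_eq]
    rw [hβ, beta_eq h0 h1, le_div_iff₀ (mul_pos h0 (by linarith))]
    linarith [hE c b h0.le h1.le]

open Filter Topology

/-! ### Lower bounds from explicit metrics -/

theorem expectedCost_le {n m : ℕ} {σ : Election n m} {p : Lottery m} {D : ℝ} (hD : 0 ≤ D)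
    (h : lotteryDistortion σ p ≤ ENNReal.ofReal D) {d : HiddenMetric n m} (hd : Consistent d σ)
    (k : Fin m) : expectedCost d p ≤ D * socialCost d k := by
  have hsc : ∀ j, 0 ≤ socialCost d j := fun j =>
    mul_nonneg (by positivity) (Finset.sum_nonneg fun v _ => @dist_nonneg _ d _ _)
  have hr : approxRatio d p ≤ ENNReal.ofReal D := (le_iSup₂ (f := fun d (_ : Consistent d σ) =>
    approxRatio d p) d hd).trans h
  unfold approxRatio at hr
  rw [ENNReal.div_le_iff_le_mul (Or.inr ENNReal.ofReal_ne_top) (Or.inl ENNReal.ofReal_ne_top),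
    ← ENNReal.ofReal_mul hD,
    ENNReal.ofReal_le_ofReal_iff (mul_nonneg hD (Real.iInf_nonneg hsc))] at hr
  exact hr.trans (mul_le_mul_of_nonneg_left
    (ciInf_le (Finite.bddBelow_range _) k) hD)

theorem monotone_fin_three {f : Fin 3 → ℝ} (h₀₁ : f 0 ≤ f 1) (h₁₂ : f 1 ≤ f 2) :
    Monotone f :=
  Fin.monotone_iff_le_succ.2 fun i => by fin_cases i <;> assumption

section Hard

variable {n : ℕ} {σ : Election n 3} {a b : ℝ}

theorem IsHardElection.cases (hn : 0 < n) (h : IsHardElection σ a b) (v : Fin n) :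
    ⇑(σ v) = ![0, 2, 1] ∨ ⇑(σ v) = ![1, 2, 0] ∨ ⇑(σ v) = ![2, 1, 0] := by
  obtain ⟨h1, h2, h3⟩ := h
  have hn' : (n : ℝ) ≠ 0 := by positivity
  have htot : rankingShare σ ![0, 2, 1] + rankingShare σ ![1, 2, 0]
      + rankingShare σ ![2, 1, 0] = 1 := by rw [h1, h2, h3]; ring
  unfold rankingShare at htot
  rw [← add_div, ← add_div, div_eq_one_iff_eq hn'] at htot
  norm_cast at htot
  have ne1 : (![0, 2, 1] : Fin 3 → Fin 3) ≠ ![1, 2, 0] := by decide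
  have ne2 : (![0, 2, 1] : Fin 3 → Fin 3) ≠ ![2, 1, 0] := by decide
  have ne3 : (![1, 2, 0] : Fin 3 → Fin 3) ≠ ![2, 1, 0] := by decide
  rw [← Finset.card_union_of_disjoint, ← Finset.card_union_of_disjoint] at htot
  · have hu := Finset.eq_univ_of_card _ (htot.trans (Fintype.card_fin n).symm)
    have := hu ▸ Finset.mem_univ v
    simpa [or_assoc] using this
  · rw [Finset.disjoint_union_left]
    constructor <;> rw [Finset.disjoint_filter] <;> intro w _ e1 e2
    exacts [ne2 (e1.symm.trans e2), ne3 (e1.symm.trans e2)]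
  · rw [Finset.disjoint_filter]
    intro w _ e1 e2
    exact ne1 (e1.symm.trans e2)

theorem IsHardElection.avg_eq (hn : 0 < n) (h : IsHardElection σ a b) {g : Fin n → ℝ}
    {g₁ g₂ g₃ : ℝ} (h₁ : ∀ v, ⇑(σ v) = ![0, 2, 1] → g v = g₁)
    (h₂ : ∀ v, ⇑(σ v) = ![1, 2, 0] → g v = g₂) (h₃ : ∀ v, ⇑(σ v) = ![2, 1, 0] → g v = g₃) :
    avg g = a * g₁ + b * g₂ + (1 - (a + b)) * g₃ := by
  have hc := h.cases hn
  obtain ⟨e1, e2, e3⟩ := h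
  have ne1 : (![0, 2, 1] : Fin 3 → Fin 3) ≠ ![1, 2, 0] := by decide
  have ne2 : (![0, 2, 1] : Fin 3 → Fin 3) ≠ ![2, 1, 0] := by decide
  have ne3 : (![1, 2, 0] : Fin 3 → Fin 3) ≠ ![2, 1, 0] := by decide
  have key : ∀ v, g v = (if ⇑(σ v) = ![0, 2, 1] then g₁ else 0)
      + (if ⇑(σ v) = ![1, 2, 0] then g₂ else 0) + (if ⇑(σ v) = ![2, 1, 0] then g₃ else 0) := by
    intro v
    rcases hc v with hv | hv | hv
    · rw [if_pos hv, if_neg (hv ▸ ne1), if_neg (hv ▸ ne2), h₁ v hv]; ring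
    · rw [if_pos hv, if_neg (hv ▸ ne1.symm), if_neg (hv ▸ ne3), h₂ v hv]; ring
    · rw [if_pos hv, if_neg (hv ▸ ne2.symm), if_neg (hv ▸ ne3.symm), h₃ v hv]; ring
  rw [← e3, ← e1, ← e2]
  unfold avg rankingShare
  rw [Finset.sum_congr rfl fun v _ => key v]
  simp only [Finset.sum_add_distrib, ← Finset.sum_filter, Finset.sum_const, nsmul_eq_mul]
  ring

open Classical in
/-- The metric pulled back from a space `E`: candidate `i` sits at `c i`, and a voter sits at `e₁`,
`e₂` or `e₃` according to whether the ranking is `132`, `231`, or anything else (in a lower-bound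
election, `321`). -/
noncomputable abbrev embeddedMetric {E : Type*} [PseudoMetricSpace E] (σ : Election n 3)
    (c : Fin 3 → E) (e₁ e₂ e₃ : E) : HiddenMetric n 3 :=
  PseudoMetricSpace.induced
    (Sum.elim (fun v => if ⇑(σ v) = ![0, 2, 1] then e₁ else if ⇑(σ v) = ![1, 2, 0] then e₂ else e₃)
      c) inferInstance

variable {E : Type*} [PseudoMetricSpace E] {c : Fin 3 → E} {e₁ e₂ e₃ : E}

theorem candDist_embedded₁ (i : Fin 3) {v : Fin n} (hv : ⇑(σ v) = ![0, 2, 1]) :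
    candDist (embeddedMetric σ c e₁ e₂ e₃) i v = dist (c i) e₁ := by
  change dist (c i) (ite _ _ _) = _
  rw [if_pos hv]

theorem candDist_embedded₂ (i : Fin 3) {v : Fin n} (hv : ⇑(σ v) = ![1, 2, 0]) :
    candDist (embeddedMetric σ c e₁ e₂ e₃) i v = dist (c i) e₂ := by
  change dist (c i) (ite _ _ _) = _
  rw [if_neg (by rw [hv]; decide), if_pos hv]

theorem candDist_embedded₃ (i : Fin 3) {v : Fin n} (hv : ⇑(σ v) = ![2, 1, 0]) :
    candDist (embeddedMetric σ c e₁ e₂ e₃) i v = dist (c i) e₃ := by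
  change dist (c i) (ite _ _ _) = _
  rw [if_neg (by rw [hv]; decide), if_neg (by rw [hv]; decide)]

theorem IsHardElection.consistent (hn : 0 < n) (h : IsHardElection σ a b)
    (m₁ : Monotone fun k => dist (c ((![0, 2, 1] : Fin 3 → Fin 3) k)) e₁)
    (m₂ : Monotone fun k => dist (c ((![1, 2, 0] : Fin 3 → Fin 3) k)) e₂)
    (m₃ : Monotone fun k => dist (c ((![2, 1, 0] : Fin 3 → Fin 3) k)) e₃) :
    Consistent (embeddedMetric σ c e₁ e₂ e₃) σ := by
  intro v i j hij
  have hle : (σ v).symm i ≤ (σ v).symm j := le_of_lt hij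
  rcases h.cases hn v with hv | hv | hv
  · simpa [candDist_embedded₁ _ hv, ← hv] using m₁ hle
  · simpa [candDist_embedded₂ _ hv, ← hv] using m₂ hle
  · simpa [candDist_embedded₃ _ hv, ← hv] using m₃ hle

theorem IsHardElection.socialCost_eq (hn : 0 < n) (h : IsHardElection σ a b) (i : Fin 3) :
    socialCost (embeddedMetric σ c e₁ e₂ e₃) i =
      a * dist (c i) e₁ + b * dist (c i) e₂ + (1 - (a + b)) * dist (c i) e₃ :=
  h.avg_eq hn (fun _ hv => candDist_embedded₁ i hv) (fun _ hv => candDist_embedded₂ i hv)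
    (fun _ hv => candDist_embedded₃ i hv)

theorem IsHardElection.cost_le (hn : 0 < n) (h : IsHardElection σ a b) {p : Lottery 3} {D : ℝ}
    (hD : 0 ≤ D) (hp : lotteryDistortion σ p ≤ ENNReal.ofReal D) {q : Fin 3 → ℝ}
    (hq : (p : Fin 3 → ℝ) = q) {x y z : E}
    (h₁ : dist x e₁ ≤ dist z e₁) (h₁' : dist z e₁ ≤ dist y e₁)
    (h₂ : dist y e₂ ≤ dist z e₂) (h₂' : dist z e₂ ≤ dist x e₂)
    (h₃ : dist z e₃ ≤ dist y e₃) (h₃' : dist y e₃ ≤ dist x e₃) (k : Fin 3) {w : E}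
    (hw : w = ![x, y, z] k) :
    q 0 * (a * dist x e₁ + b * dist x e₂ + (1 - (a + b)) * dist x e₃)
      + q 1 * (a * dist y e₁ + b * dist y e₂ + (1 - (a + b)) * dist y e₃)
      + q 2 * (a * dist z e₁ + b * dist z e₂ + (1 - (a + b)) * dist z e₃) ≤
      D * (a * dist w e₁ + b * dist w e₂ + (1 - (a + b)) * dist w e₃) := by
  have := expectedCost_le hD hp (h.consistent hn (c := ![x, y, z]) (monotone_fin_three h₁ h₁')
    (monotone_fin_three h₂ h₂') (monotone_fin_three h₃ h₃')) k
  simp only [expectedCost, h.socialCost_eq hn, Fin.sum_univ_three, hq] at this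
  exact hw ▸ this

/-- Three metrics, one for each candidate as the optimum, give three linear inequalities in the
lottery; a positive combination of them eliminates the lottery. -/
theorem IsHardElection.le_of_lotteryDistortion_le (hn : 0 < n) (h : IsHardElection σ a b)
    (hab : (a, b) ∈ admissible) {p : Lottery 3} {D : ℝ}
    (hD : 0 ≤ D) (hp : lotteryDistortion σ p ≤ ENNReal.ofReal D) :
    1 + 2 / beta (a, b) ≤ D := by
  obtain ⟨a0, a1, b0, b1, ab, hb⟩ := hab
  dsimp only at a0 a1 b0 b1 ab hb
  have a1' : 0 < 1 - a := by linarith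
  rw [div_lt_one a1'] at hb
  obtain ⟨q, hq⟩ : ∃ q, (p : Fin 3 → ℝ) = q := ⟨_, rfl⟩
  have hps : q 0 + q 1 + q 2 = 1 := by
    have := p.2.2
    rw [Fin.sum_univ_three] at this
    exact hq ▸ this
  -- Candidate `1` is optimal; everything lies on a line.
  have k1 : (q 1 + q 2) * a ≤ (D - 1) * ((1 - a) / 2) := by
    have := h.cost_le hn hD hp hq (x := (0 : ℝ)) (y := 1) (z := 1) (e₁ := 0) (e₂ := 1 / 2)
      (e₃ := 1 / 2) (k := 0) (w := 0) (hw := rfl)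
    norm_num [Real.dist_eq, abs_of_pos, abs_of_neg] at this
    linear_combination this - (1 - a) / 2 * hps
  -- Candidate `2` is optimal; the points lie in the plane with the sup norm.
  have k2 : q 0 * (1 - a) + q 2 * b ≤ (D - 1) * ((1 - b) / 2) := by
    have := h.cost_le hn hD hp hq (x := ((1 / 2 : ℝ), (1 : ℝ))) (y := (0, 0)) (z := (1, 0))
      (e₁ := (1 / 2, 1 / 2)) (e₂ := (0, 0)) (e₃ := (1 / 2, -1 / 2)) (k := 1) (w := (0, 0))
      (hw := rfl)
    norm_num [Prod.dist_eq, Real.dist_eq, abs_of_pos, abs_of_neg] at this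
    linear_combination this - (1 - b) / 2 * hps
  -- Candidate `3` is optimal; everything lies on a line.
  have k3 : q 0 * (1 - a) + q 1 * (1 - b) ≤ (D - 1) * ((a + b) / 2) := by
    have := h.cost_le hn hD hp hq (x := (1 : ℝ)) (y := -1) (z := 0) (e₁ := 1 / 2) (e₂ := -1 / 2)
      (e₃ := 0) (k := 2) (w := 0) (hw := rfl)
    norm_num [Real.dist_eq, abs_of_pos, abs_of_neg] at this
    linear_combination this - (a + b) / 2 * hps
  have hβ : 0 < beta (a, b) := by
    unfold beta
    dsimp only
    have : 0 < (-(b * (1 - b)) + (1 - a)) / a := div_pos (by linarith) a0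
    have : 0 ≤ ((1 - b) ^ 2 + b * (a + b)) / (1 - a) := by positivity
    linarith
  have hmul : beta (a, b) * (a * (1 - a)) =
      (1 - a - b * (1 - b)) * (1 - a) + a * ((1 - b) ^ 2 + b * (a + b)) := by
    unfold beta
    field_simp
    ring
  -- The multipliers of `k1`, `k2`, `k3` are the three entries of `𝟙ᵀ adj A` for this election; they
  -- make the coefficients of `q 0`, `q 1`, `q 2` equal.
  have key : 0 ≤ (a * (1 - a)) * ((D - 1) * beta (a, b) - 2) := by
    have t1 := mul_le_mul_of_nonneg_left k1 (by linarith : 0 ≤ 1 - a - b * (1 - b))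
    have t2 := mul_le_mul_of_nonneg_left k2 (mul_nonneg a0.le (by linarith : 0 ≤ 1 - b))
    have t3 := mul_le_mul_of_nonneg_left k3 (mul_nonneg a0.le b0.le)
    have e : q 0 = 1 - q 1 - q 2 := by linarith
    rw [e] at t2 t3
    linear_combination 2 * t1 + 2 * t2 + 2 * t3 - (D - 1) * hmul
  have := nonneg_of_mul_nonneg_right key (mul_pos a0 a1')
  have : 2 / beta (a, b) ≤ D - 1 := by rw [div_le_iff₀ hβ]; linarith
  linarith

theorem IsHardElection.le_electionDistortion (hn : 0 < n) (h : IsHardElection σ a b)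
    (hab : (a, b) ∈ admissible) :
    ENNReal.ofReal (1 + 2 / beta (a, b)) ≤ electionDistortion σ := by
  refine le_iInf fun p => ?_
  by_contra! hlt
  have hfin : lotteryDistortion σ p ≠ ⊤ := hlt.ne_top
  have hle := h.le_of_lotteryDistortion_le hn hab (p := p)
    (D := (lotteryDistortion σ p).toReal) ENNReal.toReal_nonneg (ENNReal.ofReal_toReal hfin).ge
  exact absurd (ENNReal.ofReal_le_ofReal hle)
    (by rw [ENNReal.ofReal_toReal hfin]; exact hlt.not_ge)

end Hard

/-- The election in which the first `A` voters submit `132`, the next `B` submit `231`, and the rest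
submit `321`. -/
def thresholdElection (A B n : ℕ) : Election n 3 := fun v =>
  if (v : ℕ) < A then Equiv.swap 1 2 else if (v : ℕ) < A + B then finRotate 3 else Equiv.swap 0 2

theorem coe_thresholdElection (A B n : ℕ) (v : Fin n) :
    ⇑(thresholdElection A B n v) = if (v : ℕ) < A then ![0, 2, 1] else
      if (v : ℕ) < A + B then ![1, 2, 0] else ![2, 1, 0] := by
  unfold thresholdElection
  split_ifs <;> decide

theorem isHardElection_thresholdElection {A B n : ℕ} (hn : 0 < n) (h : A + B ≤ n) :
    IsHardElection (thresholdElection A B n) ((A : ℝ) / n) ((B : ℝ) / n) := by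
  have hn' : (n : ℝ) ≠ 0 := by positivity
  have card_Ico : ∀ (r : Fin 3 → Fin 3) (l u : ℕ), u ≤ n →
      (∀ v : Fin n, ⇑(thresholdElection A B n v) = r ↔ l ≤ (v : ℕ) ∧ (v : ℕ) < u) →
      rankingShare (thresholdElection A B n) r = ((u - l : ℕ) : ℝ) / n := by
    intro r l u hu hr
    unfold rankingShare
    simp only [hr]
    rw [Finset.card_filter, Fin.sum_univ_eq_sum_range (fun i => if l ≤ i ∧ i < u then 1 else 0) n,
      ← Finset.card_filter, ← Nat.card_Ico]
    congr 3
    ext i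
    simp only [Finset.mem_filter, Finset.mem_range, Finset.mem_Ico]
    omega
  refine ⟨?_, ?_, ?_⟩
  · rw [card_Ico _ 0 A (by omega), Nat.sub_zero]
    intro v
    rw [coe_thresholdElection]
    split_ifs <;> simp_all
  · rw [card_Ico _ A (A + B) h, Nat.add_sub_cancel_left]
    intro v
    rw [coe_thresholdElection]
    split_ifs <;> simp_all
  · rw [card_Ico _ (A + B) n le_rfl, Nat.cast_sub h, Nat.cast_add]
    · field_simp
    intro v
    rw [coe_thresholdElection]
    split_ifs <;> simp_all
    omega

/-- Lower-bound elections have rational parameters; rounding `(a n, b n)` down to integers gives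
elections whose parameters tend to `(a, b)`. -/
theorem ofReal_le_iSup_of_mem {x : ℝ × ℝ} (hx : x ∈ admissible) (hlt : x.1 + x.2 < 1)
    (hβ : 0 < beta x) :
    ENNReal.ofReal (1 + 2 / beta x) ≤ ⨆ (n : ℕ) (σ : Election n 3) (a : ℝ) (b : ℝ) (_ : 0 < n)
      (_ : (a, b) ∈ admissible) (_ : IsHardElection σ a b), electionDistortion σ := by
  obtain ⟨a, b⟩ := x
  obtain ⟨a0, a1, b0, b1, -, hb⟩ := hx
  dsimp only at a0 a1 b0 b1 hlt hb
  have ta : Tendsto (fun n : ℕ => (⌊a * (n : ℝ)⌋₊ : ℝ) / n) atTop (𝓝 a) :=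
    (tendsto_nat_floor_mul_div_atTop a0.le).comp tendsto_natCast_atTop_atTop
  have tb : Tendsto (fun n : ℕ => (⌊b * (n : ℝ)⌋₊ : ℝ) / n) atTop (𝓝 b) :=
    (tendsto_nat_floor_mul_div_atTop b0.le).comp tendsto_natCast_atTop_atTop
  have a1' : 1 - a ≠ 0 := by linarith
  have tβ : Tendsto (fun n : ℕ => beta ((⌊a * (n : ℝ)⌋₊ : ℝ) / n, (⌊b * (n : ℝ)⌋₊ : ℝ) / n))
      atTop (𝓝 (beta (a, b))) := by
    have hc : ContinuousAt beta (a, b) := by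
      unfold beta
      exact ContinuousAt.add (ContinuousAt.div (by fun_prop) (by fun_prop) a0.ne')
        (ContinuousAt.div (by fun_prop) (by fun_prop) a1')
    exact hc.tendsto.comp (ta.prodMk_nhds tb)
  have tq : Tendsto (fun n : ℕ => (⌊b * (n : ℝ)⌋₊ : ℝ) / n * (1 - (⌊b * (n : ℝ)⌋₊ : ℝ) / n) /
      (1 - (⌊a * (n : ℝ)⌋₊ : ℝ) / n)) atTop (𝓝 (b * (1 - b) / (1 - a))) :=
    (tb.mul (tendsto_const_nhds.sub tb)).div (tendsto_const_nhds.sub ta) a1'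
  have tD : Tendsto (fun n : ℕ => ENNReal.ofReal
      (1 + 2 / beta ((⌊a * (n : ℝ)⌋₊ : ℝ) / n, (⌊b * (n : ℝ)⌋₊ : ℝ) / n)))
      atTop (𝓝 (ENNReal.ofReal (1 + 2 / beta (a, b)))) :=
    ENNReal.tendsto_ofReal (tendsto_const_nhds.add (tendsto_const_nhds.div tβ hβ.ne'))
  refine le_of_tendsto tD ?_
  filter_upwards [ta.eventually_const_lt a0, ta.eventually_lt_const a1, tb.eventually_const_lt b0,
    tb.eventually_lt_const b1, (ta.add tb).eventually_lt_const hlt, tq.eventually_lt_const hb,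
    eventually_gt_atTop 0] with n h1 h2 h3 h4 h5 h6 hn
  have hab : ((⌊a * (n : ℝ)⌋₊ : ℝ) / n, (⌊b * (n : ℝ)⌋₊ : ℝ) / n) ∈ admissible :=
    ⟨h1, h2, h3, h4, h5.le, h6⟩
  have hle : ⌊a * (n : ℝ)⌋₊ + ⌊b * (n : ℝ)⌋₊ ≤ n := by
    rw [← add_div, div_lt_one (by positivity)] at h5
    exact_mod_cast h5.le
  have hard := isHardElection_thresholdElection hn hle
  refine (hard.le_electionDistortion hn hab).trans ?_
  exact le_iSup_of_le n <| le_iSup_of_le _ <| le_iSup_of_le _ <| le_iSup_of_le _ <|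
    le_iSup_of_le hn <| le_iSup_of_le hab <| le_iSup_of_le hard le_rfl

end MetricDistortion

/-- For three candidates, the least distortion of a randomized mechanism exists and is
`1 + 2 / β`, where `β` is the minimum of `beta` over the admissible parameters. -/
theorem mainTheorem2 :
    ∃ x₀ ∈ MetricDistortion.admissible,
      IsMinOn MetricDistortion.beta MetricDistortion.admissible x₀ ∧
      (∃ f : MetricDistortion.Mechanism 3,
        MetricDistortion.distortion f = ENNReal.ofReal (1 + 2 / MetricDistortion.beta x₀)) ∧
      (∀ f : MetricDistortion.Mechanism 3,
        ENNReal.ofReal (1 + 2 / MetricDistortion.beta x₀) ≤ MetricDistortion.distortion f) ∧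
      (∀ (n : ℕ) (σ : MetricDistortion.Election n 3) (a b : ℝ), 0 < n →
        (a, b) ∈ MetricDistortion.admissible → MetricDistortion.IsHardElection σ a b →
        ENNReal.ofReal (1 + 2 / MetricDistortion.beta (a, b)) ≤
          MetricDistortion.electionDistortion σ) ∧
      (⨆ (n : ℕ) (σ : MetricDistortion.Election n 3) (a : ℝ) (b : ℝ) (_ : 0 < n)
        (_ : (a, b) ∈ MetricDistortion.admissible) (_ : MetricDistortion.IsHardElection σ a b),
        MetricDistortion.electionDistortion σ) =
          ENNReal.ofReal (1 + 2 / MetricDistortion.beta x₀) ∧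
      2.02612 < 1 + 2 / MetricDistortion.beta x₀ ∧
      1 + 2 / MetricDistortion.beta x₀ < 2.02613 := by
  obtain ⟨x₀, hx, hlt, hmin, hE, hlo, hhi⟩ := MetricDistortion.exists_optimum
  have hpos : 0 < MetricDistortion.beta x₀ := by linarith
  have hsup := MetricDistortion.ofReal_le_iSup_of_mem hx hlt hpos
  have hle : ∀ f : MetricDistortion.Mechanism 3,
      (⨆ (n : ℕ) (σ : MetricDistortion.Election n 3) (a : ℝ) (b : ℝ) (_ : 0 < n)
        (_ : (a, b) ∈ MetricDistortion.admissible) (_ : MetricDistortion.IsHardElection σ a b),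
        MetricDistortion.electionDistortion σ) ≤ MetricDistortion.distortion f := by
    intro f
    refine iSup_le fun n => iSup_le fun σ => iSup_le fun a => iSup_le fun b => iSup_le fun hn =>
      iSup_le fun _ => iSup_le fun _ => (iInf_le _ (f n σ)).trans ?_
    exact le_iSup_of_le n <| le_iSup_of_le hn <| le_iSup_of_le σ le_rfl
  have hopt : ∃ f : MetricDistortion.Mechanism 3,
      MetricDistortion.distortion f ≤ ENNReal.ofReal (1 + 2 / MetricDistortion.beta x₀) := by
    have := fun n (hn : 0 < n) => MetricDistortion.exists_lottery_le (by linarith) (by linarith)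
      hE (n := n) hn
    choose g hg using this
    classical
    refine ⟨fun n σ => if hn : 0 < n then g n hn σ else Classical.arbitrary _,
      iSup_le fun n => iSup_le fun hn => iSup_le fun σ => ?_⟩
    dsimp only
    rw [dif_pos hn]
    exact hg n hn σ
  obtain ⟨f, hf⟩ := hopt
  refine ⟨x₀, hx, hmin, ⟨f, le_antisymm hf (hsup.trans (hle f))⟩, fun f => hsup.trans (hle f),
    fun n σ a b hn hab h => h.le_electionDistortion hn hab,
    le_antisymm ((hle f).trans hf) hsup, ?_, ?_⟩
  · rw [← sub_lt_iff_lt_add', lt_div_iff₀ hpos]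
    linarith
  · rw [← lt_sub_iff_add_lt', div_lt_iff₀ hpos]
    linarith
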